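/- For a group $G$, a subset of $G$ is *elementary algebraic* if it has the form $\{x\in G: x^{\varepsilon_1}a_1x^{\varepsilon_2}a_2\cdots a_{n-1}x^{\varepsilon_n}=a_n\}$ with $n\ge 1$, $a_1,\dots,a_n\in G$ and $\varepsilon_1,\dots,\varepsilon_n\in\{-1,1\}$. The *Zariski topology* $\mathfrak Z_G$ is the topology on $G$ whose closed sets are the intersections of finite unions of elementary algebraic sets; the *Markov topology* $\mathfrak M_G$ is the topology on $G$ whose closed sets are the sets that are closed in every Hausdorff group topology on $G$. Let $[G]^{\le\omega}$ be the set of all at most countable subsets of $G$. A family $\mathcal C\subseteq[G]^{\le\omega}$ is a *club in $[G]^{\le\omega}$* if $\bigcup_{n\in\mathbb N}C_n\in\mathcal C$ for all $C_0\subseteq C_1\subseteq\cdots$ in $\mathcal C$, and every $Y\in[G]^{\le\omega}$ is contained in some $C\in\mathcal C$. Let $\mathcal S(G)$ be the set of all at most countable subgroups of $G$, and write $\mathrm{Cl}_{\mathcal T}$ for the closure in a topology $\mathcal T$. **Theorem.** For every group $G$ the following conditions are equivalent: (i) $\mathfrak M_G=\mathfrak Z_G$; (ii) for every set $A\subseteq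 G$, the family $\{H\in\mathcal S(G):\mathrm{Cl}_{\mathfrak M_H}(H\cap A)=H\cap\mathrm{Cl}_{\mathfrak M_G}A\}$ contains a club in $[G]^{\le\omega}$; (iii) for every $\mathfrak M_G$-closed set $A\subseteq G$, the family $\{H\in\mathcal S(G):H\cap A\text{ is }\mathfrak M_H\text{-closed}\}$ contains a club in $[G]^{\le\omega}$. Moreover, the equality $\mathfrak M_G=\mathfrak Z_G$ is determined by the countable subgroups of $G$, in the following sense: if $G$ and $G'$ are groups, $\Phi:\mathcal S(G)\to\mathcal S(G')$ is an isomorphism of posets (ordered by inclusion), and $\varphi_H:H\to\Phi(H)$ $(H\in\mathcal S(G))$ are group isomorphisms such that $\varphi_K$ extends $\varphi_H$ whenever $H\le K$, then $\mathfrak M_G=\mathfrak Z_G$ if and only if $\mathfrak M_{G'}=\mathfrak Z_{G'}$. -/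

import Mathlib

open scoped Topology

universe u v

namespace MarkovZariski

/-- The solution set in `G` of `x^(ε 0) * a 0 * x^(ε 1) * a 1 * ⋯ * a (n-1) * x^(ε n) = a n`,
where each sign `ε i` is `1` or `-1`. -/
def wordSet {G : Type u} [Group G] (n : ℕ) (a : Fin (n + 1) → G) (ε : Fin (n + 1) → ℤˣ) : Set G :=
  {x | (List.ofFn fun i : Fin n => x ^ (ε i.castSucc : ℤ) * a i.castSucc).prod
        * x ^ (ε (Fin.last n) : ℤ) = a (Fin.last n)}

/-- Elementary algebraic subsets of a group. -/
def IsElementaryAlgebraic {G : Type u} [Group G] (S : Set G) : Prop :=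
  ∃ (n : ℕ) (a : Fin (n + 1) → G) (ε : Fin (n + 1) → ℤˣ), S = wordSet n a ε

/-- Finite (possibly empty) unions of elementary algebraic sets. -/
def IsFiniteUnionElementary {G : Type u} [Group G] (S : Set G) : Prop :=
  ∃ F : Set (Set G), F.Finite ∧ (∀ E ∈ F, IsElementaryAlgebraic E) ∧ S = ⋃₀ F

/-- Algebraic sets: intersections of finite unions of elementary algebraic sets. -/
def IsAlgebraic {G : Type u} [Group G] (S : Set G) : Prop :=
  ∃ B : Set (Set G), (∀ T ∈ B, IsFiniteUnionElementary T) ∧ S = ⋂₀ B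

theorem IsFiniteUnionElementary.union {G : Type u} [Group G] {S T : Set G}
    (hS : IsFiniteUnionElementary S) (hT : IsFiniteUnionElementary T) :
    IsFiniteUnionElementary (S ∪ T) := by
  obtain ⟨F, hF, hF', rfl⟩ := hS
  obtain ⟨K, hK, hK', rfl⟩ := hT
  exact ⟨F ∪ K, hF.union hK, fun E hE => hE.elim (hF' E) (hK' E), (Set.sUnion_union F K).symm⟩

theorem isAlgebraic_empty {G : Type u} [Group G] : IsAlgebraic (∅ : Set G) :=
  ⟨{∅}, by
    rintro T rfl
    exact ⟨∅, Set.finite_empty, by simp, by simp⟩, by simp⟩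

theorem isAlgebraic_sInter {G : Type u} [Group G] (A : Set (Set G))
    (hA : A ⊆ {S | IsAlgebraic S}) : IsAlgebraic (⋂₀ A) := by
  refine ⟨{T | IsFiniteUnionElementary T ∧ ⋂₀ A ⊆ T}, fun T hT => hT.1, ?_⟩
  refine Set.Subset.antisymm (fun x hx T hT => hT.2 hx) (fun x hx S hS => ?_)
  obtain ⟨B, hB, rfl⟩ := hA hS
  exact fun T hT => hx T ⟨hB T hT, fun y hy => hy _ hS T hT⟩

theorem IsAlgebraic.union {G : Type u} [Group G] {S T : Set G}
    (hS : IsAlgebraic S) (hT : IsAlgebraic T) : IsAlgebraic (S ∪ T) := by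
  obtain ⟨B, hB, rfl⟩ := hS
  obtain ⟨C, hC, rfl⟩ := hT
  refine ⟨{U | ∃ P ∈ B, ∃ Q ∈ C, U = P ∪ Q}, ?_, ?_⟩
  · rintro U ⟨P, hP, Q, hQ, rfl⟩
    exact (hB P hP).union (hC Q hQ)
  · ext x
    constructor
    · rintro hx U ⟨P, hP, Q, hQ, rfl⟩
      exact hx.imp (fun h => h P hP) (fun h => h Q hQ)
    · intro hx
      by_contra hcon
      simp only [Set.mem_union, Set.mem_sInter, not_or, not_forall] at hcon
      obtain ⟨⟨P, hP, hxP⟩, Q, hQ, hxQ⟩ := hcon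
      exact (hx (P ∪ Q) ⟨P, hP, Q, hQ, rfl⟩).elim hxP hxQ

/-- The Zariski topology of a group: its closed sets are exactly the algebraic sets. -/
def zariskiTopology (G : Type u) [Group G] : TopologicalSpace G :=
  TopologicalSpace.ofClosed {S | IsAlgebraic S} isAlgebraic_empty isAlgebraic_sInter
    (fun _ hS _ hT => hS.union hT)

/-- The Markov topology of a group. In Mathlib's order on topologies `s ≤ t` means that `s` is
finer than `t`, so the `sSup` below is the intersection of all Hausdorff group topologies. -/
def markovTopology (G : Type u) [Group G] : TopologicalSpace G :=
  sSup {t : TopologicalSpace G | @IsTopologicalGroup G t _ ∧ @T2Space G t}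

theorem isClosed_zariski_iff {G : Type u} [Group G] {S : Set G} :
    IsClosed[zariskiTopology G] S ↔ IsAlgebraic S := by
  rw [← @isOpen_compl_iff G S (zariskiTopology G)]
  change IsAlgebraic Sᶜᶜ ↔ _
  rw [compl_compl]

/-- The closed sets of the Markov topology are the unconditionally closed sets. -/
theorem isClosed_markov_iff {G : Type u} [Group G] {S : Set G} :
    IsClosed[markovTopology G] S ↔
      ∀ t : TopologicalSpace G, @IsTopologicalGroup G t _ → @T2Space G t → IsClosed[t] S := by
  rw [markovTopology, isClosed_sSup_iff]
  exact ⟨fun h t h1 h2 => h t ⟨h1, h2⟩, fun h t ht => h t ht.1 ht.2⟩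

/-- Closed and unbounded families of (at most) countable subsets of `X`. -/
structure IsCountableClub {X : Type u} (C : Set (Set X)) : Prop where
  countable : ∀ Y ∈ C, Y.Countable
  iUnion_mem : ∀ s : ℕ → Set X, (∀ n, s n ∈ C) → (∀ n, s n ⊆ s (n + 1)) → (⋃ n, s n) ∈ C
  unbounded : ∀ Y : Set X, Y.Countable → ∃ Z ∈ C, Y ⊆ Z

/-- The family contains a club in the countable subsets of `X`. -/
def ContainsClub {X : Type u} (F : Set (Set X)) : Prop :=
  ∃ C : Set (Set X), IsCountableClub C ∧ C ⊆ F

/-- Countable subgroups `H` of `G` such that the Markov closure in `H` of `H ∩ A` is the trace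
on `H` of the Markov closure of `A` in `G`; subsets of `H` are written as preimages under the
inclusion `H → G`. -/
def closureReflecting {G : Type u} [Group G] (A : Set G) : Set (Set G) :=
  {Y | ∃ H : Subgroup G, (H : Set G) = Y ∧ (H : Set G).Countable ∧
    closure[markovTopology H] ((fun h : H => (h : G)) ⁻¹' A) =
      (fun h : H => (h : G)) ⁻¹' closure[markovTopology G] A}

/-- Countable subgroups `H` of `G` such that `H ∩ A` is closed in the Markov topology of `H`. -/
def closedTrace {G : Type u} [Group G] (A : Set G) : Set (Set G) :=
  {Y | ∃ H : Subgroup G, (H : Set G) = Y ∧ (H : Set G).Countable ∧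
    IsClosed[markovTopology H] ((fun h : H => (h : G)) ⁻¹' A)}

/-- The countable subgroups of a group, ordered by inclusion. -/
abbrev CountableSubgroup (G : Type u) [Group G] : Type u :=
  {H : Subgroup G // (H : Set G).Countable}

/-- An identification of the system of countable subgroups of `G` with that of `G'`: an
isomorphism of the posets of countable subgroups, and isomorphisms between corresponding
subgroups that commute with the inclusions. -/
structure CountableSubgroupsIso (G : Type u) [Group G] (G' : Type v) [Group G'] where
  toOrderIso : CountableSubgroup G ≃o CountableSubgroup G'
  iso : ∀ H : CountableSubgroup G, H.1 ≃* (toOrderIso H).1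
  compat : ∀ (H K : CountableSubgroup G) (hHK : H.1 ≤ K.1) (x : H.1),
    (iso K (Subgroup.inclusion hHK x) : G') = (iso H x : G')

end MarkovZariski

/-!
The heart of the matter is Markov's theorem that `markovTopology H = zariskiTopology H` for every
countable group `H` (`markov_eq_zariski_of_countable`). Algebraic sets are closed in every Hausdorff
group topology. Conversely, let `y` lie in the Zariski closure of `A ⊆ H`; it suffices to find a
Hausdorff group topology in which some sequence `z 0, z 1, …` in `A` converges to `y`. Enumerate
`H` as `c 0, c 1, …`, and given the sequence let `V n` be the smallest sets such that `V n` contains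
`1`, `(y⁻¹ * z n)^±1`, the products `V (n + 1) * V (n + 1)`, and the conjugates of `V (n + 1)` by
`c 0, …, c n`. They form a neighborhood base at `1` of a group topology in which `y⁻¹ * z n` tends
to `1`, and it is Hausdorff as soon as `c j ∉ V j` whenever `c j ≠ 1`
(`exists_topology_tendsto_one`). The part of `V j` that is generated by the terms up to `m` is
finite and consists of the values of finitely many words in `z m`; at `z m = y` these words give
only what the earlier terms generate. So keeping `c j` out of it, for all `j ≤ m`, amounts to
choosing `z m ∈ A` outside finitely many algebraic sets that do not contain `y`, which is possible
because `y` is in the Zariski closure of `A` (`exists_mem_forall_notMem_generated`).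

The rest is a closing-off argument. Whether `x` is in the Zariski closure of `A` is a statement
about the finite unions of elementary algebraic sets containing `A`, each of which has finitely many
coefficients, so the trace on `H` of the Zariski closure of `A` is the Zariski closure of the trace,
for all countable subgroups `H` closed under suitable choices of witnesses
(`exists_reflecting_mem_closure`, `exists_reflecting_notMem_closure`). Such subgroups form a club,
and so do those belonging in addition to a given club (`IsCountableClub.inter_isClosedUnder`). With
Markov's theorem in `H` this gives the equivalences. Finally, compatible isomorphisms between the
countable subgroups of two groups glue to an isomorphism between the groups
(`CountableSubgroupsIso.nonempty_mulEquiv`), which carries one pair of topologies to the other.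
-/

namespace MarkovZariski

/-! ### Zariski closed sets -/

section Zariski

variable {G : Type u} [Group G]

theorem IsFiniteUnionElementary.isAlgebraic {S : Set G} (hS : IsFiniteUnionElementary S) :
    IsAlgebraic S :=
  ⟨{S}, by rintro T rfl; exact hS, by simp⟩

theorem IsElementaryAlgebraic.isAlgebraic {S : Set G} (hS : IsElementaryAlgebraic S) :
    IsAlgebraic S :=
  IsFiniteUnionElementary.isAlgebraic
    ⟨{S}, Set.finite_singleton S, by rintro T rfl; exact hS, by simp⟩

theorem isAlgebraic_univ : IsAlgebraic (Set.univ : Set G) :=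
  ⟨∅, by simp, by simp⟩

theorem isAlgebraic_biUnion {ι : Type*} {s : Set ι} (hs : s.Finite) {f : ι → Set G}
    (hf : ∀ i ∈ s, IsAlgebraic (f i)) : IsAlgebraic (⋃ i ∈ s, f i) := by
  let := zariskiTopology G
  exact isClosed_zariski_iff.1
    (hs.isClosed_biUnion fun i hi => isClosed_zariski_iff.2 (hf i hi))

theorem mem_closure_zariski_iff {A : Set G} {x : G} :
    x ∈ closure[zariskiTopology G] A ↔ ∀ F, IsFiniteUnionElementary F → A ⊆ F → x ∈ F := by
  let := zariskiTopology G
  constructor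
  · intro hx F hF hAF
    exact closure_minimal hAF (isClosed_zariski_iff.2 hF.isAlgebraic) hx
  · intro h
    obtain ⟨B, hB, hBA⟩ := isClosed_zariski_iff.1 (isClosed_closure (s := A))
    rw [hBA]
    intro F hF
    refine h F (hB F hF) (subset_closure.trans ?_)
    rw [hBA]
    exact Set.sInter_subset_of_mem hF

/-- Signs and coefficients given as a list: `p` contributes the factor `x ^ p.1 * p.2`. -/
theorem isElementaryAlgebraic_setOf_list (l : List (ℤˣ × G)) (ε : ℤˣ) (g : G) :
    IsElementaryAlgebraic
      {x : G | (l.map fun p => x ^ (p.1 : ℤ) * p.2).prod * x ^ (ε : ℤ) = g} := by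
  refine ⟨l.length, Fin.snoc (α := fun _ => G) (fun i => (l.get i).2) g,
    Fin.snoc (α := fun _ => ℤˣ) (fun i => (l.get i).1) ε, ?_⟩
  ext x
  have h : l.map (fun p => x ^ (p.1 : ℤ) * p.2)
      = List.ofFn fun i => x ^ ((l.get i).1 : ℤ) * (l.get i).2 := by
    conv_lhs => rw [← List.ofFn_get l, List.map_ofFn]
    rfl
  simp only [wordSet, Set.mem_ofPred_eq, Fin.snoc_castSucc, Fin.snoc_last, h]

/-- The functions `G → G` given by words in one variable with coefficients in `G`. -/
def wordFunctions (G : Type u) [Group G] : Subgroup (G → G) :=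
  Subgroup.closure (insert id (Set.range fun g : G => fun _ => g))

theorem id_mem_wordFunctions : id ∈ wordFunctions G :=
  Subgroup.subset_closure (Set.mem_insert _ _)

theorem const_mem_wordFunctions (g : G) : (fun _ => g) ∈ wordFunctions G :=
  Subgroup.subset_closure (Set.mem_insert_of_mem _ ⟨g, rfl⟩)

theorem exists_list_of_mem_wordFunctions {w : G → G} (hw : w ∈ wordFunctions G) :
    ∃ (c : G) (l : List (ℤˣ × G)),
      ∀ x, w x = c * (l.map fun p => x ^ (p.1 : ℤ) * p.2).prod := by
  -- multiplying on the right by a constant changes only the last coefficient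
  have key : ∀ (g c : G) (l : List (ℤˣ × G)), ∃ (c' : G) (l' : List (ℤˣ × G)),
      ∀ x, c * (l.map fun p => x ^ (p.1 : ℤ) * p.2).prod * g
        = c' * (l'.map fun p => x ^ (p.1 : ℤ) * p.2).prod := by
    intro g c l
    rcases l.eq_nil_or_concat with rfl | ⟨l', ⟨ε, a⟩, rfl⟩
    · exact ⟨c * g, [], by simp⟩
    · exact ⟨c, l' ++ [(ε, a * g)], by simp [mul_assoc]⟩
  induction hw using Subgroup.closure_induction_right with
  | one => exact ⟨1, [], by simp⟩
  | mul_right f _ v hv ih =>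
    obtain ⟨c, l, h⟩ := ih
    rcases hv with rfl | ⟨g, rfl⟩
    · exact ⟨c, l ++ [(1, 1)], by simp [h, mul_assoc]⟩
    · obtain ⟨c', l', h'⟩ := key g c l
      exact ⟨c', l', fun x => by rw [← h', ← h]; rfl⟩
  | mul_inv_cancel f _ v hv ih =>
    obtain ⟨c, l, h⟩ := ih
    rcases hv with rfl | ⟨g, rfl⟩
    · exact ⟨c, l ++ [(-1, 1)], by simp [h, mul_assoc]⟩
    · obtain ⟨c', l', h'⟩ := key g⁻¹ c l
      exact ⟨c', l', fun x => by rw [← h', ← h]; rfl⟩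

theorem isAlgebraic_of_mem_wordFunctions {w : G → G} (hw : w ∈ wordFunctions G) (g : G) :
    IsAlgebraic {x | w x = g} := by
  obtain ⟨c, l, h⟩ := exists_list_of_mem_wordFunctions hw
  rcases l.eq_nil_or_concat with rfl | ⟨l', ⟨ε, a⟩, rfl⟩
  · by_cases hc : c = g
    · convert isAlgebraic_univ (G := G)
      simp [h, hc]
    · convert isAlgebraic_empty (G := G)
      simp [h, hc]
  · convert (isElementaryAlgebraic_setOf_list l' ε (c⁻¹ * g * a⁻¹)).isAlgebraic using 3 with x
    rw [h]
    simp only [List.concat_eq_append, List.map_append, List.map_cons, List.map_nil,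
      List.prod_append, List.prod_cons, List.prod_nil, mul_one]
    rw [eq_mul_inv_iff_mul_eq, eq_inv_mul_iff_mul_eq, mul_assoc]

/-- Algebraic sets are closed in every Hausdorff group topology. -/
theorem IsAlgebraic.isClosed_markov {S : Set G} (hS : IsAlgebraic S) :
    IsClosed[markovTopology G] S := by
  rw [isClosed_markov_iff]
  intro t _ _
  obtain ⟨B, hB, rfl⟩ := hS
  refine isClosed_sInter fun T hT => ?_
  obtain ⟨F, hF, hFE, rfl⟩ := hB T hT
  rw [Set.sUnion_eq_biUnion]
  refine hF.isClosed_biUnion fun E hE => ?_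
  obtain ⟨n, a, ε, rfl⟩ := hFE E hE
  refine isClosed_eq (Continuous.mul ?_ (continuous_zpow _)) continuous_const
  simp only [List.ofFn_eq_map]
  exact continuous_list_prod _ fun i _ => (continuous_zpow _).mul continuous_const

theorem markov_eq_zariski_iff :
    markovTopology G = zariskiTopology G ↔
      ∀ S : Set G, IsClosed[markovTopology G] S → IsAlgebraic S := by
  constructor
  · intro h S hS
    rw [h] at hS
    exact isClosed_zariski_iff.1 hS
  · intro h
    refine TopologicalSpace.ext_isClosed fun S => ?_
    rw [isClosed_zariski_iff]
    exact ⟨h S, IsAlgebraic.isClosed_markov⟩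

end Zariski

/-! ### Neighborhoods generated by a sequence -/

section Generated

/-- The elements of `K` that lie in the `n`-th neighborhood of `1` after at most `d` steps of
generation: the `n`-th neighborhood is to contain `1`, `b n` and `(b n)⁻¹`, all products of two
elements of the next neighborhood, and the conjugates by `c 0, …, c n` of elements of the next
neighborhood. -/
def generated {K : Type u} [Group K] (c b : ℕ → K) : ℕ → ℕ → Set K
  | 0, _ => {1}
  | d + 1, n => {1, b n, (b n)⁻¹} ∪ Set.image2 (· * ·) (generated c b d (n + 1))
      (generated c b d (n + 1)) ∪
        ⋃ i ∈ Set.Iic n, (fun x => c i * x * (c i)⁻¹) '' generated c b d (n + 1)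

variable {K : Type u} [Group K] {L : Type v} [Group L] {c b : ℕ → K} {d n : ℕ}

theorem mem_generated_zero {x : K} : x ∈ generated c b 0 n ↔ x = 1 := Iff.rfl

theorem mem_generated_succ {x : K} :
    x ∈ generated c b (d + 1) n ↔ x = 1 ∨ x = b n ∨ x = (b n)⁻¹ ∨
      (∃ y ∈ generated c b d (n + 1), ∃ z ∈ generated c b d (n + 1), y * z = x) ∨
      ∃ i ≤ n, ∃ y ∈ generated c b d (n + 1), c i * y * (c i)⁻¹ = x := by
  simp only [generated, Set.mem_union, Set.mem_insert_iff, Set.mem_singleton_iff, Set.mem_image2,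
    Set.mem_iUnion, Set.mem_Iic, Set.mem_image, exists_prop, or_assoc]

theorem one_mem_generated : (1 : K) ∈ generated c b d n := by
  cases d with
  | zero => rfl
  | succ d => exact mem_generated_succ.2 (Or.inl rfl)

theorem finite_generated : (generated c b d n).Finite := by
  induction d generalizing n with
  | zero => exact Set.finite_singleton 1
  | succ d ih =>
    exact ((Set.toFinite _).union (ih.image2 _ ih)).union
      ((Set.finite_Iic n).biUnion fun i _ => ih.image _)

theorem inv_mem_generated {x : K} (hx : x ∈ generated c b d n) : x⁻¹ ∈ generated c b d n := by
  induction d generalizing n x with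
  | zero => simpa [mem_generated_zero] using hx
  | succ d ih =>
    rw [mem_generated_succ] at hx ⊢
    rcases hx with rfl | rfl | rfl | ⟨y, hy, z, hz, rfl⟩ | ⟨i, hi, y, hy, rfl⟩
    · simp
    · simp
    · simp
    · exact Or.inr <| Or.inr <| Or.inr <| Or.inl ⟨z⁻¹, ih hz, y⁻¹, ih hy, by simp⟩
    · exact Or.inr <| Or.inr <| Or.inr <| Or.inr ⟨i, hi, y⁻¹, ih hy, by simp [mul_assoc]⟩

/-- One step of generation is monotone in the previously generated part, and reads only one
term of the sequence. -/
theorem generated_succ_subset {b' : ℕ → K} {d' : ℕ} (hb : b n = b' n ∨ b n = 1)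
    (h : generated c b d (n + 1) ⊆ generated c b' d' (n + 1)) :
    generated c b (d + 1) n ⊆ generated c b' (d' + 1) n := by
  intro x hx
  rw [mem_generated_succ] at hx ⊢
  rcases hx with rfl | rfl | rfl | ⟨y, hy, z, hz, rfl⟩ | ⟨i, hi, y, hy, rfl⟩
  · simp
  · rcases hb with hb | hb <;> simp [hb]
  · rcases hb with hb | hb <;> simp [hb]
  · exact Or.inr <| Or.inr <| Or.inr <| Or.inl ⟨y, h hy, z, h hz, rfl⟩
  · exact Or.inr <| Or.inr <| Or.inr <| Or.inr ⟨i, hi, y, h hy, rfl⟩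

theorem generated_mono {d' : ℕ} (h : d ≤ d') : generated c b d n ⊆ generated c b d' n := by
  induction d generalizing n d' with
  | zero => rintro x rfl; exact one_mem_generated
  | succ d ih =>
    obtain ⟨e, rfl⟩ := Nat.exists_eq_add_of_le' (Nat.le_of_add_left_le h)
    exact generated_succ_subset (Or.inl rfl) (ih (by omega))

theorem generated_congr {b' : ℕ → K} (h : ∀ i, n ≤ i → i < n + d → b i = b' i) :
    generated c b d n ⊆ generated c b' d n := by
  induction d generalizing n with
  | zero => exact subset_rfl
  | succ d ih =>
    exact generated_succ_subset (Or.inl (h n le_rfl (by omega)))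
      (ih fun i hi hi' => h i (by omega) (by omega))

/-- If the last term that `d + 1` steps can reach is trivial, then `d` steps suffice. -/
theorem generated_succ_subset_of_eq_one (h : b (n + d) = 1) :
    generated c b (d + 1) n ⊆ generated c b d n := by
  induction d generalizing n with
  | zero =>
    intro x hx
    rw [mem_generated_succ] at hx
    rw [add_zero] at h
    simp only [mem_generated_zero, h] at hx ⊢
    rcases hx with rfl | rfl | rfl | ⟨y, rfl, z, rfl, rfl⟩ | ⟨i, hi, y, rfl, rfl⟩ <;> simp
  | succ d ih => exact generated_succ_subset (Or.inl rfl) (ih (by rwa [add_right_comm, add_assoc]))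

theorem map_generated_subset (φ : K →* L) :
    φ '' generated c b d n ⊆ generated (φ ∘ c) (φ ∘ b) d n := by
  induction d generalizing n with
  | zero => rintro _ ⟨x, rfl, rfl⟩; exact map_one φ
  | succ d ih =>
    rintro _ ⟨x, hx, rfl⟩
    rw [mem_generated_succ] at hx ⊢
    rcases hx with rfl | rfl | rfl | ⟨y, hy, z, hz, rfl⟩ | ⟨i, hi, y, hy, rfl⟩
    · simp
    · simp
    · simp
    · exact Or.inr <| Or.inr <| Or.inr <| Or.inl
        ⟨φ y, ih ⟨y, hy, rfl⟩, φ z, ih ⟨z, hz, rfl⟩, by simp⟩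
    · exact Or.inr <| Or.inr <| Or.inr <| Or.inr ⟨i, hi, φ y, ih ⟨y, hy, rfl⟩, by simp⟩

theorem generated_comp_subset (φ : K →* L) :
    generated (φ ∘ c) (φ ∘ b) d n ⊆ φ '' generated c b d n := by
  induction d generalizing n with
  | zero => rintro _ rfl; exact ⟨1, rfl, map_one φ⟩
  | succ d ih =>
    intro x hx
    rw [mem_generated_succ] at hx
    rcases hx with rfl | rfl | rfl | ⟨y, hy, z, hz, rfl⟩ | ⟨i, hi, y, hy, rfl⟩
    · exact ⟨1, one_mem_generated, map_one φ⟩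
    · exact ⟨b n, by simp [mem_generated_succ], rfl⟩
    · exact ⟨(b n)⁻¹, by simp [mem_generated_succ], map_inv φ _⟩
    · obtain ⟨y, hy', rfl⟩ := ih hy
      obtain ⟨z, hz', rfl⟩ := ih hz
      exact ⟨y * z, mem_generated_succ.2 <|
        Or.inr <| Or.inr <| Or.inr <| Or.inl ⟨y, hy', z, hz', rfl⟩, map_mul φ y z⟩
    · obtain ⟨y, hy', rfl⟩ := ih hy
      exact ⟨c i * y * (c i)⁻¹, mem_generated_succ.2 <|
        Or.inr <| Or.inr <| Or.inr <| Or.inr ⟨i, hi, y, hy', rfl⟩, by simp⟩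

theorem generated_subset_subgroup (S : Subgroup K) (hc : ∀ i, c i ∈ S) (hb : ∀ i, b i ∈ S) :
    generated c b d n ⊆ S := by
  induction d generalizing n with
  | zero => rintro x rfl; exact S.one_mem
  | succ d ih =>
    intro x hx
    rw [mem_generated_succ] at hx
    rcases hx with rfl | rfl | rfl | ⟨y, hy, z, hz, rfl⟩ | ⟨i, hi, y, hy, rfl⟩
    · exact S.one_mem
    · exact hb n
    · exact S.inv_mem (hb n)
    · exact S.mul_mem (ih hy) (ih hz)
    · exact S.mul_mem (S.mul_mem (hc i) (ih hy)) (S.inv_mem (hc i))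

/-- If no element other than `1` is generated in all the neighborhoods, then they form a
neighborhood base at `1` of a Hausdorff group topology, in which `b` converges to `1`. -/
theorem exists_topology_tendsto_one (hc : Function.Surjective c)
    (hb : ∀ g : K, g ≠ 1 → ∃ n, ∀ d, g ∉ generated c b d n) :
    ∃ t : TopologicalSpace K, @IsTopologicalGroup K t _ ∧ @T2Space K t ∧
      Filter.Tendsto b Filter.atTop (@nhds K t 1) := by
  let V : ℕ → Set K := fun n => ⋃ d, generated c b d n
  have one_mem : ∀ n, (1 : K) ∈ V n := fun n => Set.mem_iUnion.2 ⟨0, rfl⟩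
  have mul_mem : ∀ n, ∀ x ∈ V (n + 1), ∀ y ∈ V (n + 1), x * y ∈ V n := by
    intro n x hx y hy
    obtain ⟨d, hx⟩ := Set.mem_iUnion.1 hx
    obtain ⟨e, hy⟩ := Set.mem_iUnion.1 hy
    refine Set.mem_iUnion.2 ⟨max d e + 1, mem_generated_succ.2 ?_⟩
    exact Or.inr <| Or.inr <| Or.inr <| Or.inl ⟨x, generated_mono (le_max_left d e) hx, y,
      generated_mono (le_max_right d e) hy, rfl⟩
  have anti : Antitone V := antitone_nat_of_succ_le fun n x hx => by
    simpa using mul_mem n x hx 1 (one_mem _)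
  have b_mem : ∀ n, b n ∈ V n := fun n =>
    Set.mem_iUnion.2 ⟨1, mem_generated_succ.2 (Or.inr (Or.inl rfl))⟩
  let B : GroupFilterBasis K :=
    { sets := Set.range V
      nonempty := Set.range_nonempty V
      inter_sets := by
        rintro _ _ ⟨m, rfl⟩ ⟨n, rfl⟩
        exact ⟨V (max m n), ⟨_, rfl⟩,
          Set.subset_inter (anti (le_max_left m n)) (anti (le_max_right m n))⟩
      one' := by
        rintro _ ⟨n, rfl⟩
        exact one_mem n
      mul' := by
        rintro _ ⟨n, rfl⟩
        refine ⟨V (n + 1), ⟨_, rfl⟩, ?_⟩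
        rintro _ ⟨x, hx, y, hy, rfl⟩
        exact mul_mem n x hx y hy
      inv' := by
        rintro _ ⟨n, rfl⟩
        refine ⟨V n, ⟨_, rfl⟩, fun x hx => ?_⟩
        obtain ⟨d, hx⟩ := Set.mem_iUnion.1 hx
        exact Set.mem_iUnion.2 ⟨d, inv_mem_generated hx⟩
      conj' := by
        rintro g _ ⟨n, rfl⟩
        obtain ⟨i, rfl⟩ := hc g
        refine ⟨V (max i n + 1), ⟨_, rfl⟩, fun x hx => anti (le_max_right i n) ?_⟩
        obtain ⟨d, hx⟩ := Set.mem_iUnion.1 hx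
        exact Set.mem_iUnion.2 ⟨d + 1, mem_generated_succ.2 <|
          Or.inr <| Or.inr <| Or.inr <| Or.inr ⟨i, le_max_left i n, x, hx, rfl⟩⟩ }
  refine ⟨B.topology, B.isTopologicalGroup, ?_, ?_⟩
  · let := B.topology
    rw [B.t2Space_iff_sInter_subset rfl]
    intro g hg
    by_contra hg1
    obtain ⟨n, hn⟩ := hb g hg1
    obtain ⟨d, hd⟩ := Set.mem_iUnion.1 (hg (V n) ⟨n, rfl⟩)
    exact hn d hd
  · rw [B.nhds_one_hasBasis.tendsto_right_iff]
    rintro _ ⟨n, rfl⟩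
    filter_upwards [Filter.eventually_ge_atTop n] with m hm
    exact anti hm (b_mem m)

end Generated

/-! ### Unconditionally closed subsets of countable groups -/

section Countable

variable {G : Type u} [Group G]

/-- The terms `a 0, …, a (m - 1)` can be followed by a term `y⁻¹ * z` with `z ∈ A` without
generating any of `c 0, …, c m` anew. Carrying out the generation in the group of functions `G → G`,
with `fun z => y⁻¹ * z` as the new term, shows that each of the finitely many ways of generating
`c j` is an equation for `z`; it is not solved by `y` unless `c j` was generated before. -/
theorem exists_mem_forall_notMem_generated {A : Set G} {y : G}
    (hy : y ∈ closure[zariskiTopology G] A) (c a : ℕ → G) (m : ℕ) :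
    ∃ z ∈ A, ∀ j ≤ m, c j ∉ generated c a (m - j) j →
      c j ∉ generated c (Function.update a m (y⁻¹ * z)) (m - j + 1) j := by
  let c' : ℕ → G → G := fun i _ => c i
  let b : ℕ → G → G := Function.update (fun i _ => a i) m fun z => y⁻¹ * z
  have hcb : ∀ z : G, Pi.evalMonoidHom (fun _ : G => G) z ∘ c' = c ∧
      Pi.evalMonoidHom (fun _ : G => G) z ∘ b = Function.update a m (y⁻¹ * z) := by
    intro z
    refine ⟨rfl, funext fun i => ?_⟩
    by_cases hi : i = m
    · subst hi; simp [b]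
    · simp [b, hi]
  have hc' : ∀ i, c' i ∈ wordFunctions G := fun i => const_mem_wordFunctions (c i)
  have hb : ∀ i, b i ∈ wordFunctions G := by
    intro i
    by_cases hi : i = m
    · subst hi
      simp only [b, Function.update_self]
      exact mul_mem (const_mem_wordFunctions y⁻¹) id_mem_wordFunctions
    · simp only [b, Function.update_of_ne hi]
      exact const_mem_wordFunctions (a i)
  let F : Set G := ⋃ j ∈ {j | j ≤ m ∧ c j ∉ generated c a (m - j) j},
    ⋃ w ∈ generated c' b (m - j + 1) j, {z | w z = c j}
  have hF : IsAlgebraic F :=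
    isAlgebraic_biUnion ((Set.finite_Iic m).subset fun j hj => hj.1) fun j _ =>
      isAlgebraic_biUnion finite_generated fun w hw =>
        isAlgebraic_of_mem_wordFunctions (generated_subset_subgroup _ hc' hb hw) (c j)
  have hyF : y ∉ F := by
    simp only [F, Set.mem_iUnion, not_exists]
    rintro j ⟨hj, hcj⟩ w hw hwy
    -- at `z = y` the new term is `1`, hence generates nothing new
    apply hcj
    have h1 : w y ∈ generated c (Function.update a m (y⁻¹ * y)) (m - j + 1) j := by
      have := map_generated_subset (Pi.evalMonoidHom (fun _ : G => G) y) ⟨w, hw, rfl⟩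
      rwa [(hcb y).1, (hcb y).2] at this
    have h2 := generated_succ_subset_of_eq_one
      (by rw [Nat.add_sub_cancel' hj]; simp) h1
    have h3 := generated_congr (b' := a) (fun i _ hi => Function.update_of_ne (by omega) _ _) h2
    rwa [← show w y = c j from hwy]
  let := zariskiTopology G
  have hAF : ¬ A ⊆ F := fun h =>
    hyF (closure_minimal (X := G) h (isClosed_zariski_iff.2 hF) hy)
  obtain ⟨z, hzA, hzF⟩ := Set.not_subset.1 hAF
  refine ⟨z, hzA, fun j hj hcj hmem => hzF ?_⟩
  rw [← (hcb z).2, ← (hcb z).1] at hmem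
  obtain ⟨w, hw, hwz⟩ := generated_comp_subset _ hmem
  simp only [F, Set.mem_iUnion]
  exact ⟨j, ⟨hj, hcj⟩, w, hw, hwz⟩

/-- In a countable group, a point of the Zariski closure of `A` is the limit of a sequence in `A`
with respect to some Hausdorff group topology. -/
theorem exists_topology_tendsto_of_mem_closure_zariski [Countable G] {A : Set G} {y : G}
    (hy : y ∈ closure[zariskiTopology G] A) :
    ∃ t : TopologicalSpace G, @IsTopologicalGroup G t _ ∧ @T2Space G t ∧
      ∃ z : ℕ → G, (∀ n, z n ∈ A) ∧ Filter.Tendsto z Filter.atTop (@nhds G t y) := by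
  obtain ⟨c, hc⟩ := exists_surjective_nat G
  choose next next_mem hnext using exists_mem_forall_notMem_generated hy c
  let s : ℕ → ℕ → G := fun m =>
    Nat.rec 1 (fun m a => Function.update a m (y⁻¹ * next a m)) m
  have hs : ∀ m, s (m + 1) = Function.update (s m) m (y⁻¹ * next (s m) m) := fun _ => rfl
  let z : ℕ → G := fun m => next (s m) m
  let b : ℕ → G := fun m => y⁻¹ * z m
  have hsb : ∀ m, ∀ i < m, s m i = b i := by
    intro m
    induction m with
    | zero => intro i hi; omega
    | succ m ih =>
      intro i hi
      rw [hs]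
      by_cases him : i = m
      · subst him; simp [b, z]
      · rw [Function.update_of_ne him]
        exact ih i (by omega)
  have hnot : ∀ j, c j ≠ 1 → ∀ d, c j ∉ generated c b d j := by
    intro j hj d
    induction d with
    | zero => exact hj
    | succ d ih =>
      intro hmem
      refine hnext (s (j + d)) (j + d) j (by omega) ?_ ?_
      · intro h
        rw [Nat.add_sub_cancel_left] at h
        exact ih (generated_congr (fun i _ hi => hsb _ i hi) h)
      · rw [Nat.add_sub_cancel_left, ← hs]
        exact generated_congr (fun i _ hi => (hsb _ i (by omega)).symm) hmem
  obtain ⟨t, ht, ht2, hlim⟩ := exists_topology_tendsto_one (c := c) (b := b) hc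
    (fun g hg => by obtain ⟨j, rfl⟩ := hc g; exact ⟨j, hnot j hg⟩)
  refine ⟨t, ht, ht2, z, fun n => next_mem _ _, ?_⟩
  simpa [b] using hlim.const_mul y

/-- **Markov's theorem**: the Markov and Zariski topologies of a countable group coincide. -/
theorem markov_eq_zariski_of_countable [Countable G] :
    markovTopology G = zariskiTopology G := by
  rw [markov_eq_zariski_iff]
  intro A hA
  rw [← isClosed_zariski_iff, ← @closure_subset_iff_isClosed G (zariskiTopology G)]
  intro y hy
  obtain ⟨t, ht, ht2, z, hz, hlim⟩ := exists_topology_tendsto_of_mem_closure_zariski hy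
  exact (isClosed_markov_iff.1 hA t ht ht2).mem_of_tendsto hlim (.of_forall hz)

end Countable

/-! ### Equations with coefficients in a subset -/

section Coefficients

variable {G : Type u} [Group G] {H : Type v} [Group H]

/-- Finite unions of elementary algebraic sets defined by equations with coefficients in `t`. -/
def IsFiniteUnionElementaryOver (t S : Set G) : Prop :=
  ∃ F : Set (Set G), F.Finite ∧
    (∀ E ∈ F, ∃ (n : ℕ) (a : Fin (n + 1) → G) (ε : Fin (n + 1) → ℤˣ),
      (∀ i, a i ∈ t) ∧ E = wordSet n a ε) ∧ S = ⋃₀ F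

theorem isFiniteUnionElementaryOver_univ_iff {S : Set G} :
    IsFiniteUnionElementaryOver Set.univ S ↔ IsFiniteUnionElementary S := by
  simp [IsFiniteUnionElementaryOver, IsFiniteUnionElementary, IsElementaryAlgebraic]

theorem IsFiniteUnionElementaryOver.mono {s t S : Set G} (h : s ⊆ t)
    (hS : IsFiniteUnionElementaryOver s S) : IsFiniteUnionElementaryOver t S := by
  obtain ⟨F, hF, hFs, rfl⟩ := hS
  refine ⟨F, hF, fun E hE => ?_, rfl⟩
  obtain ⟨n, a, ε, ha, rfl⟩ := hFs E hE
  exact ⟨n, a, ε, fun i => h (ha i), rfl⟩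

theorem IsFiniteUnionElementaryOver.isFiniteUnionElementary {t S : Set G}
    (hS : IsFiniteUnionElementaryOver t S) : IsFiniteUnionElementary S :=
  isFiniteUnionElementaryOver_univ_iff.1 (hS.mono (Set.subset_univ t))

theorem IsFiniteUnionElementaryOver.exists_finite {t S : Set G}
    (hS : IsFiniteUnionElementaryOver t S) :
    ∃ s ⊆ t, s.Finite ∧ IsFiniteUnionElementaryOver s S := by
  obtain ⟨F, hF, hFt, rfl⟩ := hS
  choose! n a ε ha hE using hFt
  refine ⟨⋃ E ∈ F, Set.range (a E), ?_, hF.biUnion fun E _ => Set.finite_range _, F, hF,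
    fun E hEF => ⟨n E, a E, ε E, fun i => Set.mem_biUnion hEF ⟨i, rfl⟩, hE E hEF⟩, rfl⟩
  refine Set.iUnion₂_subset fun E hEF => ?_
  rintro _ ⟨i, rfl⟩
  exact ha E hEF i

theorem countable_setOf_isFiniteUnionElementaryOver {t : Set G} (ht : t.Countable) :
    {S | IsFiniteUnionElementaryOver t S}.Countable := by
  have := ht.to_subtype
  have hE : {E : Set G | ∃ (n : ℕ) (a : Fin (n + 1) → G) (ε : Fin (n + 1) → ℤˣ),
      (∀ i, a i ∈ t) ∧ E = wordSet n a ε}.Countable := by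
    refine (Set.countable_range fun p : Σ n : ℕ, (Fin (n + 1) → t) × (Fin (n + 1) → ℤˣ) =>
      wordSet p.1 (fun i => (p.2.1 i : G)) p.2.2).mono ?_
    rintro _ ⟨n, a, ε, ha, rfl⟩
    exact ⟨⟨n, fun i => ⟨a i, ha i⟩, ε⟩, rfl⟩
  refine ((Set.countable_ofPred_finite_subset hE).image Set.sUnion).mono ?_
  rintro _ ⟨F, hF, hFt, rfl⟩
  exact ⟨F, ⟨hF, hFt⟩, rfl⟩

theorem preimage_wordSet {f : H →* G} (hf : Function.Injective f) {n : ℕ}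
    (a : Fin (n + 1) → H) (ε : Fin (n + 1) → ℤˣ) :
    f ⁻¹' wordSet n (fun i => f (a i)) ε = wordSet n a ε := by
  ext x
  simp only [wordSet, Set.mem_preimage, Set.mem_ofPred_eq]
  rw [← hf.eq_iff, map_mul, map_list_prod, List.map_ofFn, map_zpow]
  simp [Function.comp_def]

theorem IsFiniteUnionElementaryOver.preimage {f : H →* G} (hf : Function.Injective f) {S : Set G}
    (hS : IsFiniteUnionElementaryOver (Set.range f) S) : IsFiniteUnionElementary (f ⁻¹' S) := by
  obtain ⟨F, hF, hFf, rfl⟩ := hS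
  refine ⟨Set.preimage f '' F, hF.image _, ?_, ?_⟩
  · rintro _ ⟨E, hE, rfl⟩
    obtain ⟨n, a, ε, ha, rfl⟩ := hFf E hE
    choose b hb using ha
    obtain rfl : (fun i => f (b i)) = a := funext hb
    exact ⟨n, b, ε, preimage_wordSet hf b ε⟩
  · rw [Set.preimage_sUnion, Set.sUnion_image]

theorem IsFiniteUnionElementary.exists_preimage_eq {f : H →* G} (hf : Function.Injective f)
    {S : Set H} (hS : IsFiniteUnionElementary S) :
    ∃ T, IsFiniteUnionElementaryOver (Set.range f) T ∧ f ⁻¹' T = S := by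
  obtain ⟨F, hF, hFE, rfl⟩ := hS
  choose! n a ε hE using hFE
  refine ⟨⋃₀ ((fun E => wordSet (n E) (fun i => f (a E i)) (ε E)) '' F),
    ⟨_, hF.image _, ?_, rfl⟩, ?_⟩
  · rintro _ ⟨E, _, rfl⟩
    exact ⟨n E, _, ε E, fun i => ⟨_, rfl⟩, rfl⟩
  · rw [Set.sUnion_image, Set.preimage_iUnion₂, Set.sUnion_eq_biUnion]
    exact Set.iUnion₂_congr fun E hEF => by rw [preimage_wordSet hf, ← hE E hEF]

end Coefficients

/-! ### Clubs of sets closed under a set-valued operation -/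

section Club

/-- `Y` contains the value of `f` at each of its finite subsets. -/
def IsClosedUnder {X : Type u} (f : Set X → Set X) (Y : Set X) : Prop :=
  ∀ s : Set X, s.Finite → s ⊆ Y → f s ⊆ Y

theorem isCountableClub_setOf_countable (X : Type u) :
    IsCountableClub {Y : Set X | Y.Countable} :=
  ⟨fun _ hY => hY, fun _ hs _ => Set.countable_iUnion hs, fun Y hY => ⟨Y, hY, subset_rfl⟩⟩

theorem IsCountableClub.inter_isClosedUnder {X : Type u} {C : Set (Set X)}
    (hC : IsCountableClub C) {f : Set X → Set X} (hf : ∀ s : Set X, s.Finite → (f s).Countable) :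
    IsCountableClub (C ∩ {Y | IsClosedUnder f Y}) := by
  -- a finite subset of an increasing union lies in one of the sets
  have hfin : ∀ (Z : ℕ → Set X), (∀ n, Z n ⊆ Z (n + 1)) → ∀ s : Set X, s.Finite →
      s ⊆ ⋃ n, Z n → ∃ n, s ⊆ Z n := by
    intro Z hZ s hs hsZ
    rw [← Set.sUnion_range] at hsZ
    obtain ⟨_, ⟨n, rfl⟩, hn⟩ := (directedOn_range.2
      (monotone_nat_of_le_succ hZ).directed_le).exists_mem_subset_of_finite_of_subset_sUnion
        (Set.range_nonempty Z) hs hsZ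
    exact ⟨n, hn⟩
  refine ⟨fun Y hY => hC.countable Y hY.1, fun Z hZ hmono => ?_, fun Y hY => ?_⟩
  · refine ⟨hC.iUnion_mem Z (fun n => (hZ n).1) hmono, fun s hs hsZ => ?_⟩
    obtain ⟨n, hn⟩ := hfin Z hmono s hs hsZ
    exact ((hZ n).2 s hs hn).trans (Set.subset_iUnion Z n)
  · have hstep : ∀ Z : C, ∃ Z' : C, (Z : Set X) ⊆ Z' ∧
        ∀ s : Set X, s.Finite → s ⊆ Z → f s ⊆ Z' := by
      intro Z
      have hcount : (Z ∪ ⋃ s ∈ {s : Set X | s.Finite ∧ s ⊆ Z}, f s : Set X).Countable :=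
        (hC.countable Z Z.2).union <|
          (Set.countable_ofPred_finite_subset (hC.countable Z Z.2)).biUnion
            fun s hs => hf s hs.1
      obtain ⟨Z', hZ', hsub⟩ := hC.unbounded _ hcount
      refine ⟨⟨Z', hZ'⟩, Set.subset_union_left.trans hsub, fun s hs hsZ => ?_⟩
      exact (Set.subset_biUnion_of_mem (u := f) (show s ∈ {s | s.Finite ∧ s ⊆ (Z : Set X)} from
        ⟨hs, hsZ⟩)).trans (Set.subset_union_right.trans hsub)
    choose next hnext hfnext using hstep
    obtain ⟨Z₀, hZ₀, hY₀⟩ := hC.unbounded Y hY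
    let Z : ℕ → C := fun n => next^[n] ⟨Z₀, hZ₀⟩
    have hZsucc : ∀ n, Z (n + 1) = next (Z n) := fun n => Function.iterate_succ_apply' ..
    have hmono : ∀ n, (Z n : Set X) ⊆ Z (n + 1) := fun n => by
      rw [hZsucc]
      exact hnext _
    refine ⟨⋃ n, (Z n : Set X), ⟨hC.iUnion_mem _ (fun n => (Z n).2) hmono, fun s hs hsZ => ?_⟩,
      hY₀.trans (Set.subset_iUnion (fun n => (Z n : Set X)) 0)⟩
    obtain ⟨n, hn⟩ := hfin _ hmono s hs hsZ
    have := hfnext _ s hs hn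
    rw [← hZsucc] at this
    exact this.trans (Set.subset_iUnion (fun n => (Z n : Set X)) (n + 1))

variable {G : Type u} [Group G]

theorem exists_subgroup_coe_eq_of_isClosedUnder {Y : Set G}
    (hY : IsClosedUnder (fun s => insert 1 (Set.image2 (fun x y => x * y⁻¹) s s)) Y) :
    ∃ H : Subgroup G, (H : Set G) = Y := by
  have hone : (1 : G) ∈ Y := hY ∅ Set.finite_empty (Set.empty_subset Y) (Set.mem_insert 1 _)
  have hdiv : ∀ x ∈ Y, ∀ y ∈ Y, x * y⁻¹ ∈ Y := fun x hx y hy =>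
    hY {x, y} (Set.toFinite _) (by simp [Set.insert_subset_iff, hx, hy])
      (Set.mem_insert_of_mem _ ⟨x, by simp, y, by simp, rfl⟩)
  exact ⟨Subgroup.ofDiv Y ⟨1, hone⟩ hdiv, rfl⟩

theorem isCountableClub_subgroups (G : Type u) [Group G] :
    IsCountableClub {Y : Set G | Y.Countable ∧ ∃ H : Subgroup G, (H : Set G) = Y} := by
  convert (isCountableClub_setOf_countable G).inter_isClosedUnder
    (f := fun s => insert 1 (Set.image2 (fun x y => x * y⁻¹) s s))
    (fun s hs => ((hs.image2 _ hs).insert 1).countable) using 1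
  ext Y
  refine and_congr_right fun _ => ⟨?_, exists_subgroup_coe_eq_of_isClosedUnder⟩
  rintro ⟨H, rfl⟩ s - hs
  rw [Set.insert_subset_iff, Set.image2_subset_iff]
  exact ⟨H.one_mem, fun x hx y hy => H.mul_mem (hs hx) (H.inv_mem (hs hy))⟩

theorem exists_countableSubgroup_superset {Y : Set G} (hY : Y.Countable) :
    ∃ H : CountableSubgroup G, Y ⊆ H.1 := by
  obtain ⟨_, ⟨hH, H, rfl⟩, hYH⟩ := (isCountableClub_subgroups G).unbounded Y hY
  exact ⟨⟨H, hH⟩, hYH⟩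

end Club

/-! ### Reflection of the Zariski closure in countable subgroups -/

section Reflection

variable {G : Type u} [Group G]

/-- The operation chooses, for each finite union of elementary algebraic sets with coefficients
in `s` that does not cover `A`, a point of `A` outside it. -/
theorem exists_reflecting_mem_closure (A : Set G) :
    ∃ f : Set G → Set G, (∀ s : Set G, s.Finite → (f s).Countable) ∧
      ∀ H : Subgroup G, IsClosedUnder f H → ∀ x : H, (x : G) ∈ closure[zariskiTopology G] A →
        x ∈ closure[zariskiTopology H] ((fun h : H => (h : G)) ⁻¹' A) := by
  have hex : ∀ T : Set G, ∃ a, ¬ A ⊆ T → a ∈ A ∧ a ∉ T := by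
    intro T
    by_cases h : A ⊆ T
    · exact ⟨1, fun h' => (h' h).elim⟩
    · obtain ⟨a, ha⟩ := Set.not_subset.1 h
      exact ⟨a, fun _ => ha⟩
  choose a ha using hex
  refine ⟨fun s => a '' {T | IsFiniteUnionElementaryOver s T},
    fun s hs => (countable_setOf_isFiniteUnionElementaryOver hs.countable).image a, ?_⟩
  intro H hH x hx
  rw [mem_closure_zariski_iff] at hx ⊢
  intro S hS hAS
  obtain ⟨T, hT, rfl⟩ := hS.exists_preimage_eq H.subtype_injective
  refine hx T hT.isFiniteUnionElementary ?_
  by_contra hAT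
  obtain ⟨s, hs, hsfin, hsT⟩ := hT.exists_finite
  have haH : a T ∈ H := hH s hsfin (by simpa using! hs) ⟨T, hsT, rfl⟩
  exact (ha T hAT).2 (hAS (show (⟨a T, haH⟩ : H) ∈ _ from (ha T hAT).1))

/-- The operation chooses, for each `x ∈ s` outside the Zariski closure of `A`, the coefficients
of equations witnessing this. -/
theorem exists_reflecting_notMem_closure (A : Set G) :
    ∃ f : Set G → Set G, (∀ s : Set G, s.Finite → (f s).Countable) ∧
      ∀ H : Subgroup G, IsClosedUnder f H → ∀ x : H,
        x ∈ closure[zariskiTopology H] ((fun h : H => (h : G)) ⁻¹' A) →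
          (x : G) ∈ closure[zariskiTopology G] A := by
  have hex : ∀ x : G, ∃ s : Set G, s.Finite ∧ (x ∉ closure[zariskiTopology G] A →
      ∃ T, IsFiniteUnionElementaryOver s T ∧ A ⊆ T ∧ x ∉ T) := by
    intro x
    by_cases hx : x ∈ closure[zariskiTopology G] A
    · exact ⟨∅, Set.finite_empty, fun h => (h hx).elim⟩
    · have hx' := hx
      rw [mem_closure_zariski_iff] at hx'
      push Not at hx'
      obtain ⟨T, hT, hAT, hxT⟩ := hx'
      obtain ⟨s, -, hs, hsT⟩ := (isFiniteUnionElementaryOver_univ_iff.2 hT).exists_finite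
      exact ⟨s, hs, fun _ => ⟨T, hsT, hAT, hxT⟩⟩
  choose k hk hkT using hex
  refine ⟨fun s => ⋃ x ∈ s, k x, fun s hs => (hs.biUnion fun x _ => hk x).countable, ?_⟩
  intro H hH x hx
  by_contra hxA
  obtain ⟨T, hT, hAT, hxT⟩ := hkT x hxA
  have hkH : k x ⊆ H := by
    have := hH {(x : G)} (Set.finite_singleton _) (by simp)
    simpa using this
  have hTH : IsFiniteUnionElementaryOver (Set.range H.subtype) T := hT.mono (by simpa using! hkH)
  exact hxT (mem_closure_zariski_iff.1 hx _ (hTH.preimage H.subtype_injective)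
    (Set.preimage_mono hAT))

theorem containsClub_closureReflecting_of_markov_eq_zariski
    (h : markovTopology G = zariskiTopology G) (A : Set G) :
    ContainsClub (closureReflecting A) := by
  obtain ⟨f, hf, hfA⟩ := exists_reflecting_mem_closure A
  obtain ⟨g, hg, hgA⟩ := exists_reflecting_notMem_closure A
  refine ⟨_, ((isCountableClub_subgroups G).inter_isClosedUnder hf).inter_isClosedUnder hg, ?_⟩
  rintro _ ⟨⟨⟨hH, H, rfl⟩, hHf⟩, hHg⟩
  have : Countable H := hH.to_subtype
  refine ⟨H, rfl, hH, ?_⟩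
  rw [h, markov_eq_zariski_of_countable]
  ext x
  exact ⟨hgA H hHg x, hfA H hHf x⟩

theorem markov_eq_zariski_of_containsClub_closedTrace
    (h : ∀ A : Set G, IsClosed[markovTopology G] A → ContainsClub (closedTrace A)) :
    markovTopology G = zariskiTopology G := by
  rw [markov_eq_zariski_iff]
  intro A hA
  rw [← isClosed_zariski_iff, ← @closure_subset_iff_isClosed G (zariskiTopology G)]
  intro x hx
  obtain ⟨C, hC, hCA⟩ := h A hA
  obtain ⟨f, hf, hfA⟩ := exists_reflecting_mem_closure A
  obtain ⟨Y, ⟨hYC, hYf⟩, hxY⟩ :=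
    (hC.inter_isClosedUnder hf).unbounded {x} (Set.countable_singleton x)
  obtain ⟨H, rfl, hH, hHA⟩ := hCA hYC
  have : Countable H := hH.to_subtype
  rw [markov_eq_zariski_of_countable] at hHA
  have hmem := hfA H hYf ⟨x, hxY rfl⟩ hx
  rwa [@IsClosed.closure_eq H (zariskiTopology H) _ hHA] at hmem

end Reflection

/-! ### Groups with isomorphic systems of countable subgroups -/

section Transport

variable {G : Type u} [Group G] {G' : Type v} [Group G']

theorem IsAlgebraic.preimage_mulEquiv (e : G ≃* G') {S : Set G'} (hS : IsAlgebraic S) :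
    IsAlgebraic (e ⁻¹' S) := by
  obtain ⟨B, hB, rfl⟩ := hS
  refine ⟨Set.preimage e '' B, ?_, by rw [Set.preimage_sInter, Set.sInter_image]⟩
  rintro _ ⟨T, hT, rfl⟩
  refine IsFiniteUnionElementaryOver.preimage (f := e.toMonoidHom) e.injective ?_
  exact (isFiniteUnionElementaryOver_univ_iff.2 (hB T hT)).mono fun x _ => e.surjective x

theorem isClosed_markov_preimage_mulEquiv (e : G ≃* G') {S : Set G'}
    (hS : IsClosed[markovTopology G'] S) : IsClosed[markovTopology G] (e ⁻¹' S) := by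
  rw [isClosed_markov_iff] at hS ⊢
  intro t _ _
  let t' : TopologicalSpace G' := t.induced e.symm
  have hT2 : T2Space G' := T2Space.of_injective_continuous e.symm.injective continuous_induced_dom
  obtain ⟨T, hT, rfl⟩ := isClosed_induced_iff.1 (hS t' (topologicalGroup_induced e.symm) hT2)
  rwa [← Set.preimage_comp, show (e.symm ∘ e : G → G) = id from funext e.symm_apply_apply]

theorem markov_eq_zariski_of_mulEquiv (e : G ≃* G') (h : markovTopology G = zariskiTopology G) :
    markovTopology G' = zariskiTopology G' := by
  rw [markov_eq_zariski_iff] at h ⊢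
  intro S hS
  have := (h _ (isClosed_markov_preimage_mulEquiv e hS)).preimage_mulEquiv e.symm
  rwa [← Set.preimage_comp, show (e ∘ e.symm : G' → G') = id from funext e.apply_symm_apply]
    at this

/-- A group is the directed union of its countable subgroups, so the compatible isomorphisms
between the countable subgroups glue to an isomorphism between the groups. -/
theorem CountableSubgroupsIso.nonempty_mulEquiv (Φ : CountableSubgroupsIso G G') :
    Nonempty (G ≃* G') := by
  choose H hH using fun g : G => exists_countableSubgroup_superset (Set.countable_singleton g)
  let f : G → G' := fun g => Φ.iso (H g) ⟨g, hH g rfl⟩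
  -- the value does not depend on the countable subgroup used to compute it
  have hf : ∀ (K : CountableSubgroup G) (x : K.1), (Φ.iso K x : G') = f x := by
    intro K x
    obtain ⟨L, hL⟩ := exists_countableSubgroup_superset ((H (x : G)).2.union K.2)
    have hHL : (H (x : G)).1 ≤ L.1 := Set.subset_union_left.trans hL
    have hKL : K.1 ≤ L.1 := Set.subset_union_right.trans hL
    rw [← Φ.compat K L hKL x]
    exact Φ.compat (H (x : G)) L hHL ⟨x, hH _ rfl⟩
  have hpair : ∀ x y : G, ∃ (K : CountableSubgroup G) (x' y' : K.1),
      (x' : G) = x ∧ (y' : G) = y := by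
    intro x y
    obtain ⟨K, hK⟩ := exists_countableSubgroup_superset (Set.toFinite {x, y}).countable
    exact ⟨K, ⟨x, hK (by simp)⟩, ⟨y, hK (by simp)⟩, rfl, rfl⟩
  have hmul : ∀ x y, f (x * y) = f x * f y := by
    intro x y
    obtain ⟨K, x, y, rfl, rfl⟩ := hpair x y
    rw [← hf, ← hf, ← Subgroup.coe_mul, ← Subgroup.coe_mul, ← map_mul, hf]
  have hinj : Function.Injective f := by
    intro x y hxy
    obtain ⟨K, x, y, rfl, rfl⟩ := hpair x y
    rw [← hf, ← hf] at hxy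
    exact congrArg _ ((Φ.iso K).injective (Subtype.ext hxy))
  have hsurj : Function.Surjective f := by
    intro y
    obtain ⟨K', hK'⟩ := exists_countableSubgroup_superset (Set.countable_singleton y)
    obtain ⟨K, rfl⟩ := Φ.toOrderIso.surjective K'
    obtain ⟨x, hx⟩ := (Φ.iso K).surjective ⟨y, hK' rfl⟩
    exact ⟨x, by rw [← hf, hx]⟩
  exact ⟨MulEquiv.ofBijective (MonoidHom.mk' f hmul) ⟨hinj, hsurj⟩⟩

end Transport

end MarkovZariski

theorem theorem4p1 (G : Type u) [Group G] :
    List.TFAE [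
      MarkovZariski.markovTopology G = MarkovZariski.zariskiTopology G,
      ∀ A : Set G, MarkovZariski.ContainsClub (MarkovZariski.closureReflecting A),
      ∀ A : Set G, IsClosed[MarkovZariski.markovTopology G] A →
        MarkovZariski.ContainsClub (MarkovZariski.closedTrace A)] ∧
    ∀ (G' : Type v) [Group G'], Nonempty (MarkovZariski.CountableSubgroupsIso G G') →
      (MarkovZariski.markovTopology G = MarkovZariski.zariskiTopology G ↔
        MarkovZariski.markovTopology G' = MarkovZariski.zariskiTopology G') := by
  constructor
  · tfae_have 1 → 2 := MarkovZariski.containsClub_closureReflecting_of_markov_eq_zariski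
    tfae_have 2 → 3 := by
      intro h A hA
      obtain ⟨C, hC, hCA⟩ := h A
      refine ⟨C, hC, fun Y hY => ?_⟩
      obtain ⟨H, hHY, hH, hHA⟩ := hCA hY
      refine ⟨H, hHY, hH, ?_⟩
      rw [@IsClosed.closure_eq G (MarkovZariski.markovTopology G) A hA] at hHA
      exact (@closure_eq_iff_isClosed H (MarkovZariski.markovTopology H) _).1 hHA
    tfae_have 3 → 1 := MarkovZariski.markov_eq_zariski_of_containsClub_closedTrace
    tfae_finish
  · rintro G' _ ⟨Φ⟩
    obtain ⟨e⟩ := Φ.nonempty_mulEquiv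
    exact ⟨MarkovZariski.markov_eq_zariski_of_mulEquiv e,
      MarkovZariski.markov_eq_zariski_of_mulEquiv e.symm⟩
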